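/- All graphs are finite, simple and nonempty. A graph $G$ is \emph{sparse} if every nonempty (not necessarily induced) subgraph $H$ of $G$ satisfies $|E(H)|\le\lfloor\frac32|V(H)|\rfloor-1$. A graph is \emph{distance-hereditary} if it has no induced subgraph isomorphic to a house (a chordless $4$-cycle $abcd$ plus a vertex adjacent to exactly $a$ and $b$), a hole (a chordless cycle on at least five vertices), a domino (two chordless $4$-cycles whose intersection is exactly one edge and its two endpoints, with no further edges), or a gem (a chordless path on four vertices plus a vertex adjacent to all four). A square is a chordless $4$-cycle, a diamond is a $4$-cycle plus one chord, and $K_{3,3}^-$ is $K_{3,3}$ with one edge removed. \textbf{Theorem.} Let $G$ be a $2$-connected distance-hereditary graph with $n\ge 3$ vertices. Then $G$ is sparse if and only if $G$ is (isomorphic to) one of the following graphs: triangle, square, diamond, $K_{2,3}$, $K_{2,4}$, or $K_{3,3}^-$. -/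

import Mathlib

namespace DecycMatching

open SimpleGraph

/-- `v` is a cut vertex of `G`: deleting `v` leaves a disconnected graph. -/
def IsCutVertex {V : Type*} (G : SimpleGraph V) (v : V) : Prop :=
  ¬ (G.induce {v}ᶜ).Preconnected

/-- `G` is 2-connected: it has more than two vertices, it is connected and it has no cut vertex. -/
structure IsTwoConnected {V : Type*} (G : SimpleGraph V) : Prop where
  two_lt_card : 2 < Nat.card V
  connected : G.Connected
  not_isCutVertex : ∀ v : V, ¬ IsCutVertex G v

/-- A subgraph `H` (of a finite graph) is bad if `|E(H)| > ⌊(3/2)|V(H)|⌋ - 1`. -/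
def IsBad {V : Type*} {G : SimpleGraph V} (H : G.Subgraph) : Prop :=
  (H.edgeSet.ncard : ℤ) > ⌊(3 / 2 : ℚ) * (H.verts.ncard : ℚ)⌋ - 1

/-- `G` is sparse if it has no bad (nonempty, not necessarily induced) subgraph. -/
def IsSparse {V : Type*} (G : SimpleGraph V) : Prop :=
  ∀ H : G.Subgraph, H.verts.Nonempty → ¬ IsBad H

/-- The gem: the path `0 1 2 3` and a vertex `4` adjacent to all of it. -/
def gem : SimpleGraph (Fin 5) :=
  fromEdgeSet {s(0, 1), s(1, 2), s(2, 3), s(0, 4), s(1, 4), s(2, 4), s(3, 4)}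

/-- The house: the 4-cycle `0 1 2 3` and a vertex `4` adjacent to `0` and `1`. -/
def house : SimpleGraph (Fin 5) :=
  fromEdgeSet {s(0, 1), s(1, 2), s(2, 3), s(0, 3), s(0, 4), s(1, 4)}

/-- The domino: the two 4-cycles `0 1 2 3` and `1 4 5 2`, which share the edge `1 2`. -/
def domino : SimpleGraph (Fin 6) :=
  fromEdgeSet {s(0, 1), s(1, 2), s(2, 3), s(0, 3), s(1, 4), s(4, 5), s(2, 5)}

/-- `G` is distance-hereditary: it has no induced house, hole (chordless cycle on at least five
vertices), domino or gem. -/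
structure IsDistanceHereditary {V : Type*} (G : SimpleGraph V) : Prop where
  house_free : ¬ house.IsIndContained G
  hole_free : ∀ k : ℕ, 5 ≤ k → ¬ (cycleGraph k).IsIndContained G
  domino_free : ¬ domino.IsIndContained G
  gem_free : ¬ gem.IsIndContained G

/-- The triangle `K₃`. -/
def triangle : SimpleGraph (Fin 3) := completeGraph (Fin 3)

/-- The square: the chordless 4-cycle. -/
def square : SimpleGraph (Fin 4) := cycleGraph 4

/-- The diamond: the 4-cycle `0 1 2 3` plus the chord `0 2`. -/
def diamond : SimpleGraph (Fin 4) :=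
  fromEdgeSet {s(0, 1), s(1, 2), s(2, 3), s(0, 3), s(0, 2)}

/-- The complete bipartite graph `K_{p,q}`. -/
abbrev K (p q : ℕ) : SimpleGraph (Fin p ⊕ Fin q) := completeBipartiteGraph (Fin p) (Fin q)

/-- `K_{3,3}` minus one edge. -/
def K33Minus : SimpleGraph (Fin 3 ⊕ Fin 3) :=
  (K 3 3).deleteEdges {s(Sum.inl 0, Sum.inr 0)}

end DecycMatching

namespace DecycMatching

open SimpleGraph

/-! A 2-connected graph is grown from an edge by ears. If an induced connected proper subgraph `S`
has no outside vertex with two neighbours in `S`, take a shortest path leaving `S` and returning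
elsewhere, and close it by a shortest path inside `S`: the cycle is chordless, so without holes it
is a square on an edge of `S` (`exists_ear`). If that edge already lies in a triangle or an induced
square of `S`, this gives a house or a domino. So beyond the first step a vertex with two neighbours
in `S` can always be added (`exists_two_neighbors`).

Sparsity then leaves almost no room. With (vertices, edges): an edge grows to a triangle (3,3) or a
square (4,4). Each next vertex has exactly two neighbours, and house-freeness forbids adjacent ones
in a square or in `K 2 3`. Hence triangle → diamond (4,5), square → `K 2 3` (5,6) → `K 2 4` or
`K33Minus` (6,8), and there two further edges exceed the bound.

The converse is a finite check over vertex sets. -/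

/-! ### Ears in graphs without cut vertices and holes -/

theorem cycleGraph_isIndContained {V : Type*} {G : SimpleGraph V} {k : ℕ} (f : ℕ → V)
    (hinj : ∀ i j, i < j → j < k → f i ≠ f j)
    (hadj : ∀ i j, i < j → j < k → (G.Adj (f i) (f j) ↔ j = i + 1 ∨ (i = 0 ∧ j + 1 = k))) :
    (cycleGraph k).IsIndContained G := by
  have key : ∀ a b : Fin k, a < b →
      (G.Adj (f a) (f b) ↔ (cycleGraph k).Adj a b) := by
    intro a b hab
    have hab' : a.val < b.val := hab
    have hb := b.isLt
    rw [hadj a b hab' hb, cycleGraph_adj', Fin.coe_sub_iff_lt.2 hab, Fin.coe_sub_iff_le.2 hab.le]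
    omega
  refine ⟨⟨⟨fun i => f i, ?_⟩, ?_⟩⟩
  · intro a b h
    rcases lt_trichotomy a b with hab | hab | hab
    · exact absurd h (hinj a b hab b.isLt)
    · exact hab
    · exact absurd h.symm (hinj b a hab a.isLt)
  · intro a b
    change G.Adj (f a) (f b) ↔ _
    rcases lt_trichotomy a b with hab | rfl | hab
    · exact key a b hab
    · simp
    · rw [G.adj_comm, (cycleGraph k).adj_comm]
      exact key b a hab

/-- A shortcut between two vertices of a geodesic would shorten the whole walk. -/
theorem Walk.dist_getVert_of_length_eq_dist {V : Type*} {G : SimpleGraph V} {u v : V}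
    (p : G.Walk u v) (hp : p.length = G.dist u v) {i j : ℕ} (hij : i ≤ j) (hj : j ≤ p.length) :
    G.dist (p.getVert i) (p.getVert j) = j - i := by
  have h1 : G.dist u (p.getVert i) ≤ i :=
    (dist_le (p.take i)).trans (by simp [Walk.take_length])
  have h2 : G.dist (p.getVert j) v ≤ p.length - j :=
    (dist_le (p.drop j)).trans (by simp [Walk.drop_length])
  have h3 : ∃ q : G.Walk (p.getVert i) (p.getVert j), q.length ≤ j - i := by
    have e : (p.drop i).getVert (j - i) = p.getVert j := by
      rw [Walk.drop_getVert]; congr 1; omega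
    exact ⟨((p.drop i).take (j - i)).copy rfl e, by simp [Walk.take_length]⟩
  obtain ⟨q, hq⟩ := h3
  have h4 := dist_le q
  obtain ⟨a, ha⟩ := q.reachable.exists_walk_length_eq_dist
  have h6 : G.dist u v ≤ G.dist u (p.getVert i) + a.length + G.dist (p.getVert j) v := by
    obtain ⟨c, hc⟩ := (p.take i).reachable.exists_walk_length_eq_dist
    obtain ⟨b, hb⟩ := (p.drop j).reachable.exists_walk_length_eq_dist
    have := dist_le ((c.append a).append b)
    simp only [Walk.length_append] at this
    omega
  omega

/-- In a graph without cut vertex, two vertices of `S` are joined by a path whose edges are not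
inside `S`, as soon as `S` is proper and has two vertices. -/
theorem exists_reachable_sdiff {V : Type*} {G : SimpleGraph V}
    (hG : ∀ v : V, ¬ IsCutVertex G v) {S : Set V} (hS : S.Nontrivial) {x : V} (hx : x ∉ S)
    {G₁ : SimpleGraph V} (hG₁ : ∀ a b, G.Adj a b → a ∉ S → G₁.Adj a b) :
    ∃ s ∈ S, ∃ t ∈ S, s ≠ t ∧ G₁.Reachable s t := by
  by_contra! h
  -- The `G₁`-component of `x` meets `S` in at most one vertex; if in none, any `s` serves. This `s`
  -- would separate `x` from the rest of `S`.
  have hs : ∃ s ∈ S, ∀ t ∈ S, G₁.Reachable x t → t = s := by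
    by_cases h0 : ∃ s ∈ S, G₁.Reachable x s
    · obtain ⟨s, hs, hxs⟩ := h0
      refine ⟨s, hs, fun t ht hxt => ?_⟩
      by_contra hts
      exact h s hs t ht (Ne.symm hts) (hxs.symm.trans hxt)
    · obtain ⟨s, hs⟩ := hS.nonempty
      exact ⟨s, hs, fun t ht hxt => absurd ⟨t, ht, hxt⟩ h0⟩
  obtain ⟨s, hs, hsu⟩ := hs
  obtain ⟨t, ht, hts⟩ := hS.exists_ne s
  have hconn : (G.induce {s}ᶜ).Preconnected := not_not.1 (hG s)
  have hxs : x ≠ s := fun h => hx (h ▸ hs)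
  obtain ⟨w⟩ := hconn ⟨x, hxs⟩ ⟨t, hts⟩
  have key : ∀ (a b : ({s}ᶜ : Set V)) (w : (G.induce {s}ᶜ).Walk a b),
      G₁.Reachable x a → a.1 ∉ S → b.1 ∉ S := by
    intro a b w
    induction w with
    | nil => exact fun _ h => h
    | @cons a c b hac w ih =>
      intro hxa haS
      have hac' : G₁.Adj a c := hG₁ _ _ hac haS
      have hxc : G₁.Reachable x c := hxa.trans hac'.reachable
      exact ih hxc fun hcS => c.2 (hsu _ hcS hxc)
  exact key _ _ w (Reachable.refl x) hx ht

theorem Walk.adj_getVert_iff_of_length_eq_dist {V : Type*} {G : SimpleGraph V} {u v : V}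
    (p : G.Walk u v) (hp : p.length = G.dist u v) {i j : ℕ} (hij : i ≤ j) (hj : j ≤ p.length) :
    G.Adj (p.getVert i) (p.getVert j) ↔ j = i + 1 := by
  rw [← dist_eq_one_iff_adj, Walk.dist_getVert_of_length_eq_dist p hp hij hj]
  omega

theorem Walk.getVert_ne_of_length_eq_dist {V : Type*} {G : SimpleGraph V} {u v : V}
    (p : G.Walk u v) (hp : p.length = G.dist u v) {i j : ℕ} (hij : i < j) (hj : j ≤ p.length) :
    p.getVert i ≠ p.getVert j := by
  intro h
  have := Walk.dist_getVert_of_length_eq_dist p hp hij.le hj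
  rw [h, dist_self] at this
  omega

/-- In a hole-free graph without cut vertex, a connected proper vertex set `S` has an ear which
is either a single vertex or an edge forming a square with an edge inside `S`. -/
theorem exists_ear {V : Type*} {G : SimpleGraph V}
    (hG : ∀ v : V, ¬ IsCutVertex G v)
    (hole : ∀ k : ℕ, 5 ≤ k → ¬ (cycleGraph k).IsIndContained G)
    {S : Set V} (hS : S.Nontrivial) (hSc : (G.induce S).Preconnected) (hSu : ∃ x, x ∉ S) :
    (∃ x ∉ S, ∃ s ∈ S, ∃ t ∈ S, s ≠ t ∧ G.Adj x s ∧ G.Adj x t) ∨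
    (∃ x ∉ S, ∃ y ∉ S, ∃ s ∈ S, ∃ t ∈ S, G.Adj s t ∧ G.Adj x y ∧
      (∀ z ∈ S, G.Adj x z ↔ z = s) ∧ (∀ z ∈ S, G.Adj y z ↔ z = t)) := by
  by_cases hno : ∃ x ∉ S, ∃ s ∈ S, ∃ t ∈ S, s ≠ t ∧ G.Adj x s ∧ G.Adj x t
  · exact Or.inl hno
  right
  replace hno : ∀ x ∉ S, ∀ s ∈ S, ∀ t ∈ S, G.Adj x s → G.Adj x t → s = t := by
    intro x hx s hs t ht h1 h2
    by_contra h
    exact hno ⟨x, hx, s, hs, t, ht, h, h1, h2⟩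
  -- `G₁` keeps the edges not inside `S`, `G₂` those inside `S`.
  let G₁ : SimpleGraph V :=
    { Adj := fun a b => G.Adj a b ∧ ¬ (a ∈ S ∧ b ∈ S)
      symm := ⟨fun a b h => ⟨h.1.symm, fun h' => h.2 h'.symm⟩⟩
      loopless := ⟨fun a h => G.loopless.irrefl a h.1⟩ }
  let G₂ : SimpleGraph V :=
    { Adj := fun a b => G.Adj a b ∧ (a ∈ S ∧ b ∈ S)
      symm := ⟨fun a b h => ⟨h.1.symm, h.2.symm⟩⟩
      loopless := ⟨fun a h => G.loopless.irrefl a h.1⟩ }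
  obtain ⟨x₀, hx₀⟩ := hSu
  have hex : ∃ n, ∃ s ∈ S, ∃ t ∈ S, s ≠ t ∧ G₁.Reachable s t ∧ G₁.dist s t = n := by
    obtain ⟨s, hs, t, ht, hst, hr⟩ := exists_reachable_sdiff hG hS hx₀ (G₁ := G₁)
      (fun a b h ha => ⟨h, fun h' => ha h'.1⟩)
    exact ⟨_, s, hs, t, ht, hst, hr, rfl⟩
  classical
  obtain ⟨s, hs, t, ht, hst, hr, hd⟩ := Nat.find_spec hex
  have hmin : ∀ a ∈ S, ∀ b ∈ S, a ≠ b → G₁.Reachable a b → G₁.dist s t ≤ G₁.dist a b := by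
    intro a ha b hb hab hab'
    rw [hd]
    exact Nat.find_min' hex ⟨a, ha, b, hb, hab, hab', rfl⟩
  clear hd
  obtain ⟨p, hp⟩ := hr.exists_walk_length_eq_dist
  set l := p.length with hl
  obtain ⟨P, hPe⟩ : ∃ P : ℕ → V, P = p.getVert := ⟨_, rfl⟩
  have hP0 : P 0 = s := by rw [hPe]; exact p.getVert_zero
  have hPl : P l = t := by rw [hPe]; exact p.getVert_length
  have hdist : ∀ i j, i ≤ j → j ≤ l → G₁.dist (P i) (P j) = j - i :=
    fun i j hij hj => hPe ▸ Walk.dist_getVert_of_length_eq_dist p hp hij hj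
  have hPadj : ∀ i j, i ≤ j → j ≤ l → (G₁.Adj (P i) (P j) ↔ j = i + 1) :=
    fun i j hij hj => hPe ▸ Walk.adj_getVert_iff_of_length_eq_dist p hp hij hj
  have hPne : ∀ i j, i < j → j ≤ l → P i ≠ P j :=
    fun i j hij hj => hPe ▸ Walk.getVert_ne_of_length_eq_dist p hp hij hj
  have hreach : ∀ i j, G₁.Reachable (P i) (P j) := fun i j =>
    hPe ▸ (p.take i).reachable.symm.trans (p.take j).reachable
  have hout : ∀ i, 0 < i → i < l → P i ∉ S := by
    intro i hi hil hiS
    have h1 := hmin s hs _ hiS (by rw [← hP0]; exact hPne 0 i hi hil.le)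
      (by rw [← hP0]; exact hreach 0 i)
    have h2 := hdist 0 i hi.le hil.le
    rw [hP0] at h2
    omega
  have hl0 : l ≠ 0 := by
    intro h
    rw [h, hP0] at hPl
    exact hst hPl
  have hl1 : l ≠ 1 := by
    intro h
    have := (hPadj 0 1 (by omega) (by omega)).2 rfl
    rw [h] at hPl
    rw [hP0, hPl] at this
    exact this.2 ⟨hs, ht⟩
  have hl2 : l ≠ 2 := by
    intro h
    have h1 := (hPadj 0 1 (by omega) (by omega)).2 rfl
    have h2 := (hPadj 1 2 (by omega) (by omega)).2 rfl
    rw [h] at hPl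
    rw [hP0] at h1
    rw [hPl] at h2
    exact hst (hno _ (hout 1 (by omega) (by omega)) s hs t ht h1.1.symm h2.1)
  -- A neighbour `z` in `S` other than `s`, `t` would give return paths of lengths `i + 1` and `l -
  -- i + 1`; minimality of `l` forces `i = 1` and `l = 2`, already excluded.
  have hattach : ∀ i, 0 < i → i < l → ∀ z ∈ S, G.Adj (P i) z →
      (i = 1 ∧ z = s) ∨ (i + 1 = l ∧ z = t) := by
    intro i hi hil z hz hadj
    have hadj₁ : G₁.Adj (P i) z := ⟨hadj, fun h => hout i hi hil h.1⟩
    have h0 := hdist 0 i hi.le hil.le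
    have h1 := hdist i l hil.le le_rfl
    rw [hP0] at h0
    rw [hPl] at h1
    have hri := hreach 0 i
    have hrl := hreach i l
    rw [hP0] at hri
    rw [hPl] at hrl
    have d1 := dist_eq_one_iff_adj.2 hadj₁
    by_cases hzs : z = s
    · subst hzs
      rw [SimpleGraph.dist_comm] at d1
      left; exact ⟨by omega, rfl⟩
    by_cases hzt : z = t
    · subst hzt
      right; exact ⟨by omega, rfl⟩
    have h2 := hmin s hs z hz (Ne.symm hzs) (hri.trans hadj₁.reachable)
    have h3 := hmin z hz t ht hzt (hadj₁.symm.reachable.trans hrl)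
    obtain ⟨a, ha⟩ := hri.exists_walk_length_eq_dist
    obtain ⟨b, hb⟩ := hrl.exists_walk_length_eq_dist
    have h4 := dist_le (a.append hadj₁.toWalk)
    have h5 := dist_le (hadj₁.symm.toWalk.append b)
    simp only [Walk.length_append, Walk.length_cons, Walk.length_nil] at h4 h5
    omega
  have hr₂ : G₂.Reachable t s := by
    obtain ⟨w⟩ := hSc ⟨t, ht⟩ ⟨s, hs⟩
    let φ : (G.induce S) →g G₂ := ⟨Subtype.val, fun {a b} h => ⟨h, a.2, b.2⟩⟩
    exact (w.map φ).reachable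
  obtain ⟨q, hq⟩ := hr₂.exists_walk_length_eq_dist
  set d := q.length with hdd
  obtain ⟨Q, hQe⟩ : ∃ Q : ℕ → V, Q = q.getVert := ⟨_, rfl⟩
  have hQ0 : Q 0 = t := by rw [hQe]; exact q.getVert_zero
  have hQd : Q d = s := by rw [hQe]; exact q.getVert_length
  have hQadj : ∀ i j, i ≤ j → j ≤ d → (G₂.Adj (Q i) (Q j) ↔ j = i + 1) :=
    fun i j hij hj => hQe ▸ Walk.adj_getVert_iff_of_length_eq_dist q hq hij hj
  have hQne : ∀ i j, i < j → j ≤ d → Q i ≠ Q j :=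
    fun i j hij hj => hQe ▸ Walk.getVert_ne_of_length_eq_dist q hq hij hj
  have hQS : ∀ i, i ≤ d → Q i ∈ S := by
    intro i hi
    rcases hi.eq_or_lt with rfl | hi
    · rw [hQd]; exact hs
    · exact ((hQadj i (i + 1) (by omega) (by omega)).2 rfl).2.1
  have hd0 : d ≠ 0 := by
    intro h
    rw [h, hQ0] at hQd
    exact hst hQd.symm
  -- The closed walk takes `P` from `s` up to just before `t`, then `Q` from `t` up to just before
  -- `s`, so it has `l + d` vertices.
  let f : ℕ → V := fun i => if i < l then P i else Q (i - l)
  have fP : ∀ i, i < l → f i = P i := fun i hi => if_pos hi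
  have fQ : ∀ i, l ≤ i → f i = Q (i - l) := fun i hi => if_neg (by omega)
  have hcyc : ¬ 5 ≤ l + d := by
    intro h5
    refine hole _ h5 (cycleGraph_isIndContained f ?_ ?_)
    · intro i j hij hj
      by_cases hjl : j < l
      · rw [fP i (by omega), fP j hjl]
        exact hPne i j hij hjl.le
      by_cases hil : i < l
      · rw [fP i hil, fQ j (by omega)]
        rcases Nat.eq_zero_or_pos i with rfl | hi
        · rw [hP0, ← hQd]
          exact (hQne _ _ (by omega) le_rfl).symm
        · intro h
          exact hout i hi hil (h ▸ hQS _ (by omega))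
      · rw [fQ i (by omega), fQ j (by omega)]
        exact hQne _ _ (by omega) (by omega)
    · intro i j hij hj
      by_cases hjl : j < l
      · rw [fP i (by omega), fP j hjl]
        have h1 := hPadj i j hij.le hjl.le
        have h2 : G₁.Adj (P i) (P j) ↔ G.Adj (P i) (P j) :=
          ⟨fun h => h.1, fun h => ⟨h, fun h' => hout j (by omega) hjl h'.2⟩⟩
        rw [← h2, h1]
        omega
      by_cases hil : i < l
      · rw [fP i hil, fQ j (by omega)]
        have hjS := hQS (j - l) (by omega)
        rcases Nat.eq_zero_or_pos i with rfl | hi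
        · have h1 := hQadj (j - l) d (by omega) le_rfl
          have h2 : G₂.Adj (Q (j - l)) (Q d) ↔
              G.Adj (Q (j - l)) (Q d) :=
            ⟨fun h => h.1, fun h => ⟨h, hjS, hQS d le_rfl⟩⟩
          rw [hP0, ← hQd, G.adj_comm, ← h2, h1]
          omega
        · constructor
          · intro h
            rcases hattach i hi hil _ hjS h with ⟨-, h'⟩ | ⟨h', h''⟩
            · rw [← hQd] at h'
              exact absurd h' (hQne _ _ (by omega) le_rfl)
            · left
              by_contra hji
              rw [← hQ0] at h''
              exact absurd h''.symm (hQne _ _ (by omega) (by omega))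
          · intro h
            have hji : j = l := by omega
            have hil' : i + 1 = l := by omega
            have := (hPadj i l hil.le le_rfl).2 hil'.symm
            rw [hPl] at this
            rw [hji, Nat.sub_self, hQ0]
            exact this.1
      · rw [fQ i (by omega), fQ j (by omega)]
        have h1 := hQadj (i - l) (j - l) (by omega) (by omega)
        have h2 : G₂.Adj (Q (i - l)) (Q (j - l)) ↔
            G.Adj (Q (i - l)) (Q (j - l)) :=
          ⟨fun h => h.1, fun h => ⟨h, hQS _ (by omega), hQS _ (by omega)⟩⟩
        rw [← h2, h1]
        omega
  have hl3 : l = 3 := by omega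
  have hd1 : d = 1 := by omega
  rw [hl3] at hPl
  rw [hd1] at hQd
  have a01 := ((hPadj 0 1 (by omega) (by omega)).2 rfl).1
  have a12 := ((hPadj 1 2 (by omega) (by omega)).2 rfl).1
  have a23 := ((hPadj 2 3 (by omega) (by omega)).2 rfl).1
  have b01 := ((hQadj 0 1 (by omega) (by omega)).2 rfl).1
  rw [hP0] at a01
  rw [hPl] at a23
  rw [hQ0, hQd] at b01
  refine ⟨P 1, hout 1 (by omega) (by omega), P 2, hout 2 (by omega) (by omega),
    s, hs, t, ht, b01.symm, a12, ?_, ?_⟩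
  · intro z hz
    constructor
    · intro h
      rcases hattach 1 (by omega) (by omega) z hz h with h' | h'
      · exact h'.2
      · omega
    · rintro rfl
      exact a01.symm
  · intro z hz
    constructor
    · intro h
      rcases hattach 2 (by omega) (by omega) z hz h with h' | h'
      · omega
      · exact h'.2
    · rintro rfl
      exact a23

/-! ### Edge counts in sparse graphs -/

theorem floor_three_halves (n : ℕ) : ⌊(3 / 2 : ℚ) * (n : ℚ)⌋ = ((3 * n / 2 : ℕ) : ℤ) := by
  have h := Nat.floor_div_eq_div (K := ℚ) (3 * n) 2
  rw [← h, Int.natCast_floor_eq_floor (by positivity)]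
  congr 1
  push_cast
  ring

theorem IsSparse.card_edges_lt {V : Type*} [Finite V] {G : SimpleGraph V} (h : IsSparse G)
    {W : Finset V} (hW : W.Nonempty) (E : Finset (Sym2 V)) (hE : ∀ e ∈ E, e ∈ G.edgeSet)
    (hEW : ∀ e ∈ E, ∀ v ∈ e, v ∈ W) : E.card + 1 ≤ 3 * W.card / 2 := by
  have h1 := h ((⊤ : G.Subgraph).induce W) (by simpa using hW)
  have h2 : (E : Set (Sym2 V)) ⊆ ((⊤ : G.Subgraph).induce W).edgeSet := by
    intro e he
    have ha := hE e he
    have hb := hEW e he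
    induction e with
    | _ a b =>
      simp only [Subgraph.mem_edgeSet, Subgraph.induce_adj, Subgraph.top_adj]
      exact ⟨hb a (by simp), hb b (by simp), ha⟩
  have h3 := Set.ncard_le_ncard h2 (Set.toFinite _)
  rw [IsBad, Subgraph.induce_verts, Set.ncard_coe_finset, floor_three_halves] at h1
  rw [Set.ncard_coe_finset] at h3
  omega

/-- In a sparse graph, a vertex outside an induced copy of `H` has few neighbours in it. -/
theorem IsSparse.card_edgeFinset_add_card_lt {V W : Type*} [Finite V] [Fintype W] [DecidableEq W]
    {G : SimpleGraph V} (h : IsSparse G) {H : SimpleGraph W} [DecidableRel H.Adj] (φ : H ↪g G)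
    {x : V} (hx : ∀ i, φ i ≠ x) (N : Finset W) (hN : ∀ i ∈ N, G.Adj x (φ i)) :
    H.edgeFinset.card + N.card + 1 ≤ 3 * (Fintype.card W + 1) / 2 := by
  classical
  have hxm : x ∉ Finset.univ.map φ.toEmbedding := by
    simpa using hx
  have hdisj : Disjoint (H.edgeFinset.map φ.toEmbedding.sym2Map)
      (N.map ⟨fun i => s(x, φ i), fun i j hij => by
        rcases Sym2.eq_iff.1 hij with h | h
        · exact φ.injective h.2
        · exact φ.injective (h.2.trans h.1)⟩) := by
    rw [Finset.disjoint_left]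
    intro e he he'
    obtain ⟨e', -, rfl⟩ := Finset.mem_map.1 he
    obtain ⟨i, -, hi⟩ := Finset.mem_map.1 he'
    have hmem : x ∈ φ.toEmbedding.sym2Map e' := by
      rw [← hi]
      exact Sym2.mem_mk_left _ _
    obtain ⟨j, -, hj⟩ := Sym2.mem_map.1 hmem
    exact hx j hj
  have := h.card_edges_lt (W := Finset.cons x _ hxm) (Finset.cons_nonempty _)
    (Finset.disjUnion _ _ hdisj) ?_ ?_
  · rw [Finset.card_disjUnion, Finset.card_map, Finset.card_map, Finset.card_cons,
      Finset.card_map, Finset.card_univ] at this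
    exact this
  · intro e he
    rw [Finset.mem_disjUnion, Finset.mem_map, Finset.mem_map] at he
    rcases he with ⟨e, he, rfl⟩ | ⟨i, hi, rfl⟩
    · induction e with
      | _ a b =>
        rw [mem_edgeFinset, mem_edgeSet] at he
        exact φ.map_rel_iff.2 he
    · exact hN i hi
  · intro e he v hv
    rw [Finset.mem_disjUnion, Finset.mem_map, Finset.mem_map] at he
    rw [Finset.mem_cons]
    rcases he with ⟨e, he, rfl⟩ | ⟨i, hi, rfl⟩
    · obtain ⟨j, -, rfl⟩ := Sym2.mem_map.1 hv
      exact Or.inr (Finset.mem_map_of_mem _ (Finset.mem_univ j))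
    · rcases Sym2.mem_iff.1 hv with rfl | rfl
      · exact Or.inl rfl
      · exact Or.inr (Finset.mem_map_of_mem _ (Finset.mem_univ i))

/-! ### Sparsity of the six graphs -/

/-- Among subgraphs on a given vertex set the induced one has the most edges, so only vertex sets
need checking, which makes the condition decidable. -/
theorem isSparse_of_iso {V W : Type*} [Fintype W] [DecidableEq W] {G : SimpleGraph V}
    {H : SimpleGraph W} [DecidableRel H.Adj] (e : G ≃g H)
    (h : ∀ S : Finset W, S.Nonempty → (S.sym2 ∩ H.edgeFinset).card + 1 ≤ 3 * S.card / 2) :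
    IsSparse G := by
  classical
  intro K hK
  let S : Finset W := (e '' K.verts).toFinset
  have hS : S.card = K.verts.ncard := by
    rw [← Set.ncard_eq_toFinset_card', Set.ncard_image_of_injective _ e.injective]
  have hE : K.edgeSet.ncard ≤ (S.sym2 ∩ H.edgeFinset).card := by
    rw [← Set.ncard_coe_finset,
      ← Set.ncard_image_of_injective K.edgeSet (Sym2.map.injective e.injective)]
    refine Set.ncard_le_ncard ?_ (Finset.finite_toSet _)
    rintro _ ⟨s, hs, rfl⟩
    induction s with
    | _ a b =>
      rw [Subgraph.mem_edgeSet] at hs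
      simp only [Sym2.map_mk, Finset.coe_inter, Set.mem_inter_iff, Finset.mem_coe,
        Finset.mk_mem_sym2_iff, mem_edgeFinset, mem_edgeSet]
      refine ⟨⟨?_, ?_⟩, e.map_rel_iff.2 hs.adj_sub⟩
      · exact Set.mem_toFinset.2 ⟨a, hs.fst_mem, rfl⟩
      · exact Set.mem_toFinset.2 ⟨b, hs.snd_mem, rfl⟩
  have := h S (by simpa [S] using hK)
  rw [IsBad, floor_three_halves]
  omega

instance : DecidableRel triangle.Adj := fun a b => decidable_of_iff (a ≠ b) Iff.rfl

instance : DecidableRel square.Adj := inferInstanceAs (DecidableRel (cycleGraph 4).Adj)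

instance : DecidableRel diamond.Adj :=
  inferInstanceAs (DecidableRel (fromEdgeSet _).Adj)

instance (p q : ℕ) : DecidableRel (K p q).Adj := fun a b =>
  decidable_of_iff ((a.isLeft ∧ b.isRight) ∨ (a.isRight ∧ b.isLeft)) Iff.rfl

instance : DecidableRel K33Minus.Adj := fun a b =>
  decidable_of_iff ((K 3 3).Adj a b ∧ s(a, b) ≠ s(Sum.inl 0, Sum.inr 0))
    (by simp [K33Minus, deleteEdges_adj])

theorem isSparse_of_iso_list {V : Type*} {G : SimpleGraph V}
    (h : Nonempty (G ≃g triangle) ∨ Nonempty (G ≃g square) ∨ Nonempty (G ≃g diamond) ∨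
        Nonempty (G ≃g K 2 3) ∨ Nonempty (G ≃g K 2 4) ∨ Nonempty (G ≃g K33Minus)) :
    IsSparse G := by
  rcases h with ⟨⟨e⟩⟩ | ⟨⟨e⟩⟩ | ⟨⟨e⟩⟩ | ⟨⟨e⟩⟩ | ⟨⟨e⟩⟩ | ⟨⟨e⟩⟩ <;>
    exact isSparse_of_iso e (by decide +kernel)

/-! ### Recognising induced houses and dominoes -/

theorem isIndContained_of_lt {V : Type*} {G : SimpleGraph V} {n : ℕ} {H : SimpleGraph (Fin n)}
    (f : Fin n → V)
    (h : ∀ i j, i < j → f i ≠ f j ∧ (G.Adj (f i) (f j) ↔ H.Adj i j)) : H.IsIndContained G := by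
  refine ⟨⟨⟨f, ?_⟩, ?_⟩⟩
  · intro i j hij
    rcases lt_trichotomy i j with hlt | heq | hlt
    · exact absurd hij (h i j hlt).1
    · exact heq
    · exact absurd hij.symm (h j i hlt).1
  · intro i j
    change G.Adj (f i) (f j) ↔ _
    rcases lt_trichotomy i j with hlt | rfl | hlt
    · exact (h i j hlt).2
    · simp
    · rw [G.adj_comm, H.adj_comm]
      exact (h j i hlt).2

/-- Non-adjacent vertices need not be assumed distinct: each such pair is told apart by a third
vertex adjacent to only one of them. -/
theorem house_isIndContained {V : Type*} {G : SimpleGraph V} {a b c d x : V}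
    (hab : G.Adj a b) (hbc : G.Adj b c) (hcd : G.Adj c d) (had : G.Adj a d)
    (hac : ¬ G.Adj a c) (hbd : ¬ G.Adj b d) (hxa : G.Adj a x) (hxb : G.Adj b x)
    (hxc : ¬ G.Adj c x) (hxd : ¬ G.Adj d x) : house.IsIndContained G := by
  have n1 : a ≠ c := fun e => hxc (e ▸ hxa)
  have n2 : b ≠ d := fun e => hxd (e ▸ hxb)
  have n3 : c ≠ x := fun e => hac (e ▸ hxa)
  have n4 : d ≠ x := fun e => hbd (e ▸ hxb)
  refine isIndContained_of_lt ![a, b, c, d, x] fun i j hij => ?_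
  fin_cases i <;> fin_cases j <;> first
    | exact absurd hij (by decide)
    | simp [house, *, hab.ne, hbc.ne, hcd.ne, had.ne, hxa.ne, hxb.ne]

theorem domino_isIndContained {V : Type*} {G : SimpleGraph V} {a b c d x y : V}
    (hab : G.Adj a b) (hbc : G.Adj b c) (hcd : G.Adj c d) (had : G.Adj a d)
    (hac : ¬ G.Adj a c) (hbd : ¬ G.Adj b d)
    (hbx : G.Adj b x) (hxy : G.Adj x y) (hcy : G.Adj c y)
    (hax : ¬ G.Adj a x) (hcx : ¬ G.Adj c x) (hdx : ¬ G.Adj d x)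
    (hay : ¬ G.Adj a y) (hby : ¬ G.Adj b y) (hdy : ¬ G.Adj d y) : domino.IsIndContained G := by
  have n1 : a ≠ c := fun e => hay (e ▸ hcy)
  have n2 : b ≠ d := fun e => hdx (e ▸ hbx)
  have n3 : a ≠ x := fun e => hay (e ▸ hxy)
  have n4 : c ≠ x := fun e => hdx (e ▸ hcd.symm)
  have n5 : d ≠ x := fun e => hdy (e ▸ hxy)
  have n6 : a ≠ y := fun e => hax (e ▸ hxy.symm)
  have n7 : b ≠ y := fun e => hay (e ▸ hab)
  have n8 : d ≠ y := fun e => hdx (e ▸ hxy.symm)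
  refine isIndContained_of_lt ![a, b, c, d, x, y] fun i j hij => ?_
  fin_cases i <;> fin_cases j <;> first
    | exact absurd hij (by decide)
    | simp [domino, *, hab.ne, hbc.ne, hcd.ne, had.ne, hbx.ne, hxy.ne, hcy.ne]

/-! ### Extending an induced subgraph by one vertex -/

/-- Every edge of `H` lies in a triangle or in an induced square. -/
def EdgesInSmallCycles {W : Type*} (H : SimpleGraph W) : Prop :=
  ∀ s t, H.Adj s t → (∃ u, H.Adj s u ∧ H.Adj t u) ∨
    ∃ u v, H.Adj t u ∧ H.Adj u v ∧ H.Adj s v ∧ ¬ H.Adj s u ∧ ¬ H.Adj t v ∧ s ≠ u ∧ t ≠ v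

instance {W : Type*} [Fintype W] [DecidableEq W] (H : SimpleGraph W) [DecidableRel H.Adj] :
    Decidable (EdgesInSmallCycles H) := by
  unfold EdgesInSmallCycles
  infer_instance

theorem exists_ear_of_embedding {V W : Type*} {G : SimpleGraph V} {H : SimpleGraph W}
    [Nontrivial W] (hG : IsTwoConnected G)
    (hole : ∀ k : ℕ, 5 ≤ k → ¬ (cycleGraph k).IsIndContained G)
    (φ : H ↪g G) (hH : H.Preconnected) (hs : ¬ Function.Surjective φ) :
    (∃ x, (∀ i, φ i ≠ x) ∧ ∃ i j, i ≠ j ∧ G.Adj x (φ i) ∧ G.Adj x (φ j)) ∨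
    (∃ x y, (∀ i, φ i ≠ x) ∧ (∀ i, φ i ≠ y) ∧ G.Adj x y ∧ ∃ s t, H.Adj s t ∧
      (∀ i, G.Adj x (φ i) ↔ i = s) ∧ (∀ i, G.Adj y (φ i) ↔ i = t)) := by
  have hout : ∀ x, x ∉ Set.range φ → ∀ i, φ i ≠ x := fun x hx i hi => hx ⟨i, hi⟩
  have hpre : (G.induce (Set.range φ)).Preconnected := by
    let ψ : H →g G.induce (Set.range φ) :=
      ⟨fun i => ⟨φ i, i, rfl⟩, fun {a b} h => φ.map_rel_iff.2 h⟩
    refine hH.map ψ ?_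
    rintro ⟨_, i, rfl⟩
    exact ⟨i, rfl⟩
  have hnt : (Set.range φ).Nontrivial := by
    obtain ⟨a, b, hab⟩ := exists_pair_ne W
    exact ⟨φ a, ⟨a, rfl⟩, φ b, ⟨b, rfl⟩, fun h => hab (φ.injective h)⟩
  have hex : ∃ x, x ∉ Set.range φ := by
    by_contra! h
    exact hs h
  rcases exists_ear hG.not_isCutVertex hole hnt hpre hex with h | h
  · obtain ⟨x, hx, _, ⟨i, rfl⟩, _, ⟨j, rfl⟩, hij, hxi, hxj⟩ := h
    exact Or.inl ⟨x, hout x hx, i, j, fun h => hij (h ▸ rfl), hxi, hxj⟩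
  · obtain ⟨x, hx, y, hy, _, ⟨s, rfl⟩, _, ⟨t, rfl⟩, hst, hxy, hxs, hyt⟩ := h
    refine Or.inr ⟨x, y, hout x hx, hout y hy, hxy, s, t, φ.map_rel_iff.1 hst, ?_, ?_⟩
    · intro i
      rw [hxs _ ⟨i, rfl⟩, φ.injective.eq_iff]
    · intro i
      rw [hyt _ ⟨i, rfl⟩, φ.injective.eq_iff]

/-- An ear `x y` on an edge `s t` makes a square; a triangle on `s t` turns it into a house, an
induced square on `s t` into a domino. -/
theorem exists_two_neighbors {V W : Type*} {G : SimpleGraph V} {H : SimpleGraph W}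
    [Nontrivial W] (hG : IsTwoConnected G) (hdh : IsDistanceHereditary G)
    (φ : H ↪g G) (hH : H.Preconnected) (hc : EdgesInSmallCycles H)
    (hs : ¬ Function.Surjective φ) :
    ∃ x, (∀ i, φ i ≠ x) ∧ ∃ i j, i ≠ j ∧ G.Adj x (φ i) ∧ G.Adj x (φ j) := by
  rcases exists_ear_of_embedding hG hdh.hole_free φ hH hs with h | h
  · exact h
  obtain ⟨x, y, -, -, hxy, s, t, hst, hx, hy⟩ := h
  exfalso
  have φadj : ∀ i j, G.Adj (φ i) (φ j) ↔ H.Adj i j := fun i j => φ.map_rel_iff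
  rcases hc s t hst with ⟨u, hsu, htu⟩ | ⟨u, v, htu, huv, hsv, nsu, ntv, nesu, netv⟩
  · exact hdh.house_free (house_isIndContained (a := φ s) (b := φ t) (c := y) (d := x) (x := φ u)
      ((φadj _ _).2 hst) ((hy t).2 rfl).symm hxy.symm ((hx s).2 rfl).symm
      (fun h => hst.ne ((hy s).1 h.symm)) (fun h => hst.ne' ((hx t).1 h.symm))
      ((φadj _ _).2 hsu) ((φadj _ _).2 htu) (fun h => htu.ne' ((hy u).1 h))
      (fun h => hsu.ne' ((hx u).1 h)))
  · exact hdh.domino_free (domino_isIndContained (a := φ v) (b := φ s) (c := φ t) (d := φ u)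
      (x := x) (y := y) ((φadj _ _).2 hsv.symm) ((φadj _ _).2 hst) ((φadj _ _).2 htu)
      ((φadj _ _).2 huv.symm) (fun h => ntv ((φadj _ _).1 h.symm)) (fun h => nsu ((φadj _ _).1 h))
      ((hx s).2 rfl).symm hxy ((hy t).2 rfl).symm (fun h => hsv.ne' ((hx v).1 h.symm))
      (fun h => hst.ne' ((hx t).1 h.symm)) (fun h => nesu ((hx u).1 h.symm).symm)
      (fun h => netv ((hy v).1 h.symm).symm) (fun h => hst.ne ((hy s).1 h.symm))
      (fun h => htu.ne' ((hy u).1 h.symm)))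

/-- `hcard` says that one more vertex with two edges breaks sparsity, so the copy of `H` cannot
grow. -/
theorem surjective_of_card {V W : Type*} [Finite V] [Fintype W] [DecidableEq W] [Nontrivial W]
    {G : SimpleGraph V} {H : SimpleGraph W} [DecidableRel H.Adj] (hG : IsTwoConnected G)
    (hdh : IsDistanceHereditary G) (hsp : IsSparse G)
    (φ : H ↪g G) (hH : H.Preconnected) (hc : EdgesInSmallCycles H)
    (hcard : 3 * (Fintype.card W + 1) / 2 < H.edgeFinset.card + 3) :
    Function.Surjective φ := by
  by_contra hs
  obtain ⟨x, hx, i, j, hij, hxi, hxj⟩ := exists_two_neighbors hG hdh φ hH hc hs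
  have := hsp.card_edgeFinset_add_card_lt φ hx {i, j} (by simp [hxi, hxj])
  rw [Finset.card_pair hij] at this
  omega

/-- Here the edge count leaves room for two new edges but not for three. -/
theorem surjective_or_exists_eq_pair {V W : Type*} [Finite V] [Fintype W] [DecidableEq W]
    [Nontrivial W]
    {G : SimpleGraph V} {H : SimpleGraph W} [DecidableRel H.Adj] (hG : IsTwoConnected G)
    (hdh : IsDistanceHereditary G) (hsp : IsSparse G)
    (φ : H ↪g G) (hH : H.Preconnected) (hc : EdgesInSmallCycles H)
    (hcard : 3 * (Fintype.card W + 1) / 2 < H.edgeFinset.card + 4) :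
    Function.Surjective φ ∨ ∃ x, (∀ i, φ i ≠ x) ∧ ∃ i j, i ≠ j ∧
      ∀ k, G.Adj x (φ k) ↔ k = i ∨ k = j := by
  by_cases hs : Function.Surjective φ
  · exact Or.inl hs
  obtain ⟨x, hx, i, j, hij, hxi, hxj⟩ := exists_two_neighbors hG hdh φ hH hc hs
  refine Or.inr ⟨x, hx, i, j, hij, fun k => ⟨fun hk => ?_, ?_⟩⟩
  · by_contra! hne
    have := hsp.card_edgeFinset_add_card_lt φ hx {i, j, k} (by simp [hxi, hxj, hk])
    rw [Finset.card_eq_three.2 ⟨i, j, k, hij, hne.1.symm, hne.2.symm, rfl⟩] at this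
    omega
  · rintro (rfl | rfl) <;> assumption

theorem nonempty_iso_of_surjective {V W : Type*} {G : SimpleGraph V} {H : SimpleGraph W}
    (φ : H ↪g G) (hs : Function.Surjective φ) : Nonempty (G ≃g H) :=
  ⟨(RelIso.ofSurjective φ hs).symm⟩

/-! ### The individual extension steps -/

/-- The two kinds of ear on a single edge give the two outcomes. -/
theorem triangle_or_square_isIndContained {V : Type*} {G : SimpleGraph V}
    (hG : IsTwoConnected G) (hole : ∀ k : ℕ, 5 ≤ k → ¬ (cycleGraph k).IsIndContained G) :
    triangle.IsIndContained G ∨ square.IsIndContained G := by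
  have hfin : Finite V := Nat.finite_of_card_ne_zero (by have := hG.two_lt_card; omega)
  have hnt : Nontrivial V :=
    Finite.one_lt_card_iff_nontrivial.1 (by have := hG.two_lt_card; omega)
  obtain ⟨a⟩ := hG.connected.nonempty
  obtain ⟨b, hab⟩ := hG.connected.preconnected.exists_adj_of_nontrivial a
  have hK : (completeGraph (Fin 2)).IsIndContained G := by
    refine isIndContained_of_lt ![a, b] fun i j hij => ?_
    fin_cases i <;> fin_cases j <;> first
      | exact absurd hij (by decide)
      | simp [hab, hab.ne, completeGraph]
  obtain ⟨φ⟩ := hK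
  have hs : ¬ Function.Surjective φ := by
    intro hs
    have h1 := Nat.card_le_card_of_surjective φ hs
    have h2 := hG.two_lt_card
    rw [Nat.card_fin] at h1
    omega
  have hadj : ∀ i j, G.Adj (φ i) (φ j) ↔ i ≠ j := fun i j => φ.map_rel_iff
  rcases exists_ear_of_embedding hG hole φ (by decide +kernel) hs with h | h
  · left
    obtain ⟨x, hx, i, j, hij, hxi, hxj⟩ := h
    have := hadj i j
    have := hx i
    have := hx j
    refine isIndContained_of_lt ![φ i, φ j, x] fun k l hkl => ?_
    fin_cases k <;> fin_cases l <;> first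
      | exact absurd hkl (by decide)
      | simp [triangle, completeGraph, hxi.symm, hxj.symm, *]
  · right
    obtain ⟨x, y, hx, hy, hxy, s, t, hst, hxs, hyt⟩ := h
    have hst' : s ≠ t := hst
    have hxs' : ∀ i, G.Adj (φ i) x ↔ i = s := fun i => (G.adj_comm _ _).trans (hxs i)
    have hyt' : ∀ i, G.Adj (φ i) y ↔ i = t := fun i => (G.adj_comm _ _).trans (hyt i)
    refine isIndContained_of_lt ![φ s, φ t, y, x] fun k l hkl => ?_
    fin_cases k <;> fin_cases l <;> first
      | exact absurd hkl (by decide)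
      | simp [square, cycleGraph_adj, hxs', hyt', hadj, hx, hy, hst', hst'.symm,
          hxy.symm, hxy.ne'] <;> decide

theorem diamond_isIndContained_of_triangle {V : Type*} {G : SimpleGraph V} (φ : triangle ↪g G)
    {x : V} (hx : ∀ i, φ i ≠ x) {i j : Fin 3} (hij : i ≠ j)
    (h : ∀ k, G.Adj x (φ k) ↔ k = i ∨ k = j) : diamond.IsIndContained G := by
  obtain ⟨k, hki, hkj⟩ : ∃ k : Fin 3, k ≠ i ∧ k ≠ j := by
    clear h; revert i j; decide
  have hadj : ∀ i j, G.Adj (φ i) (φ j) ↔ i ≠ j := fun i j => φ.map_rel_iff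
  have hx' : ∀ i, x ≠ φ i := fun i => (hx i).symm
  have h' : ∀ k, G.Adj (φ k) x ↔ k = i ∨ k = j := fun k => (G.adj_comm _ _).trans (h k)
  -- The common neighbours of `x` and `φ k` are the ends of the chord.
  refine isIndContained_of_lt ![φ i, x, φ j, φ k] fun a b hab => ?_
  fin_cases a <;> fin_cases b <;> first
    | exact absurd hab (by decide)
    | simp [diamond, h', hadj, h, hx, hx', hij, hki, hki.symm, hkj, hkj.symm]

theorem K_isIndContained {V : Type*} {G : SimpleGraph V} {p q : ℕ} (f : Fin p → V) (g : Fin q → V)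
    (hf : f.Injective) (hg : g.Injective) (hff : ∀ i j, ¬ G.Adj (f i) (f j))
    (hgg : ∀ i j, ¬ G.Adj (g i) (g j)) (hfg : ∀ i j, G.Adj (f i) (g j)) :
    (K p q).IsIndContained G := by
  refine ⟨⟨⟨Sum.elim f g, hf.sumElim hg fun i j => (hfg i j).ne⟩, ?_⟩⟩
  rintro (i | i) (j | j) <;> simp [hff, hgg, hfg, (hfg _ _).symm]

theorem K33Minus_isIndContained {V : Type*} {G : SimpleGraph V} (f g : Fin 3 → V)
    (hf : f.Injective) (hg : g.Injective) (hff : ∀ i j, ¬ G.Adj (f i) (f j))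
    (hgg : ∀ i j, ¬ G.Adj (g i) (g j)) (hfg : ∀ i j, G.Adj (f i) (g j) ↔ ¬ (i = 0 ∧ j = 0)) :
    K33Minus.IsIndContained G := by
  have hne : ∀ i j, f i ≠ g j := by
    intro i j hij
    by_cases h : i = 0 ∧ j = 0
    · have := (hfg 1 j).2 (by simp)
      rw [← hij] at this
      exact hff _ _ this
    · exact ((hfg i j).2 h).ne hij
  have hgf : ∀ i j, G.Adj (g j) (f i) ↔ ¬ (i = 0 ∧ j = 0) :=
    fun i j => (G.adj_comm _ _).trans (hfg i j)
  refine ⟨⟨⟨Sum.elim f g, hf.sumElim hg hne⟩, ?_⟩⟩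
  rintro (i | i) (j | j) <;>
    simp [hff, hgg, hfg, hgf, K33Minus, deleteEdges_adj]
  tauto

/-- If `i`, `j` are adjacent, `x` is the roof of a house; if opposite, `x` is a third common
neighbour of them. -/
theorem K23_isIndContained_of_square {V : Type*} {G : SimpleGraph V}
    (hG : ¬ house.IsIndContained G) (φ : square ↪g G)
    {x : V} (hx : ∀ i, φ i ≠ x) {i j : Fin 4} (hij : i ≠ j)
    (h : ∀ k, G.Adj x (φ k) ↔ k = i ∨ k = j) : (K 2 3).IsIndContained G := by
  have hadj : ∀ i j, G.Adj (φ i) (φ j) ↔ square.Adj i j := fun i j => φ.map_rel_iff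
  have hx' : ∀ i, x ≠ φ i := fun i => (hx i).symm
  have h' : ∀ k, G.Adj (φ k) x ↔ k = i ∨ k = j := fun k => (G.adj_comm _ _).trans (h k)
  by_cases hadj_ij : square.Adj i j
  · obtain ⟨k, l, hjk, hkl, hil, hik, hjl, h1, h2, h3, h4⟩ : ∃ k l : Fin 4,
        square.Adj j k ∧ square.Adj k l ∧ square.Adj i l ∧ ¬ square.Adj i k ∧ ¬ square.Adj j l ∧
        k ≠ i ∧ k ≠ j ∧ l ≠ i ∧ l ≠ j := by
      clear h h'; revert i j; decide
    refine absurd (house_isIndContained (a := φ i) (b := φ j) (c := φ k) (d := φ l) (x := x)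
      ?_ ?_ ?_ ?_ ?_ ?_ ?_ ?_ ?_ ?_) hG
    all_goals simp [*]
  · obtain ⟨k, l, hkl, nkl, nlk, nji, hik, hil, hjk, hjl, h1, h2, h3, h4⟩ : ∃ k l : Fin 4,
        k ≠ l ∧ ¬ square.Adj k l ∧ ¬ square.Adj l k ∧ ¬ square.Adj j i ∧
        square.Adj i k ∧ square.Adj i l ∧ square.Adj j k ∧ square.Adj j l ∧
        k ≠ i ∧ k ≠ j ∧ l ≠ i ∧ l ≠ j := by
      clear h h'; revert i j; decide
    refine K_isIndContained ![φ i, φ j] ![φ k, φ l, x] ?_ ?_ ?_ ?_ ?_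
    · intro a b
      fin_cases a <;> fin_cases b <;> simp [hij, hij.symm]
    · intro a b
      fin_cases a <;> fin_cases b <;> simp [hkl, hkl.symm, hx, hx']
    all_goals
      intro a b
      fin_cases a <;> fin_cases b <;> simp [*]

set_option synthInstance.maxHeartbeats 200000 in
theorem K24_or_K33Minus_isIndContained {V : Type*} {G : SimpleGraph V}
    (hG : ¬ house.IsIndContained G) (φ : K 2 3 ↪g G)
    {x : V} (hx : ∀ i, φ i ≠ x) {i j : Fin 2 ⊕ Fin 3} (hij : i ≠ j)
    (h : ∀ k, G.Adj x (φ k) ↔ k = i ∨ k = j) :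
    (K 2 4).IsIndContained G ∨ K33Minus.IsIndContained G := by
  have hadj : ∀ i j, G.Adj (φ i) (φ j) ↔ (K 2 3).Adj i j := fun i j => φ.map_rel_iff
  have hx' : ∀ i, x ≠ φ i := fun i => (hx i).symm
  have h' : ∀ k, G.Adj (φ k) x ↔ k = i ∨ k = j := fun k => (G.adj_comm _ _).trans (h k)
  have hnot : ¬ (K 2 3).Adj i j := by
    intro hadj_ij
    -- Every edge of `K 2 3` lies in an induced square, on which `x` would be the roof of a house.
    obtain ⟨k, l, hjk, hkl, hil, hik, hjl, h1, h2, h3, h4⟩ : ∃ k l : Fin 2 ⊕ Fin 3,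
        (K 2 3).Adj j k ∧ (K 2 3).Adj k l ∧ (K 2 3).Adj i l ∧ ¬ (K 2 3).Adj i k ∧
        ¬ (K 2 3).Adj j l ∧ k ≠ i ∧ k ≠ j ∧ l ≠ i ∧ l ≠ j := by
      clear h h' hij; revert i j; decide +kernel
    refine hG (house_isIndContained (a := φ i) (b := φ j) (c := φ k) (d := φ l) (x := x)
      ?_ ?_ ?_ ?_ ?_ ?_ ?_ ?_ ?_ ?_)
    all_goals simp only [*, or_true, true_or, or_self, not_false_eq_true]
  rcases i with i | i <;> rcases j with j | j
  · left
    have hij' : i ≠ j := fun e => hij (e ▸ rfl)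
    have hk : ∀ k : Fin 2, k = i ∨ k = j := by
      clear h h' hnot hij; revert i j; decide
    refine K_isIndContained ![φ (Sum.inl 0), φ (Sum.inl 1)]
      ![φ (Sum.inr 0), φ (Sum.inr 1), φ (Sum.inr 2), x] ?_ ?_ ?_ ?_ ?_
    all_goals
      intro a b
      fin_cases a <;> fin_cases b <;> simp [h, h', hadj, hx, hx', hk]
  · exact absurd (by simp) hnot
  · exact absurd (by simp) hnot
  · right
    have hij' : i ≠ j := fun e => hij (e ▸ rfl)
    obtain ⟨k, hki, hkj⟩ : ∃ k : Fin 3, k ≠ i ∧ k ≠ j := by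
      clear h h' hnot hij; revert i j; decide
    -- Now `x` joins the side of size two and misses only `φ (Sum.inr k)`; both go to index `0`,
    -- where the edge is deleted.
    refine K33Minus_isIndContained ![x, φ (Sum.inl 0), φ (Sum.inl 1)]
      ![φ (Sum.inr k), φ (Sum.inr i), φ (Sum.inr j)] ?_ ?_ ?_ ?_ ?_
    all_goals
      intro a b
      fin_cases a <;> fin_cases b <;>
        simp [h, h', hadj, hx, hx', hij', hij'.symm, hki, hkj, hki.symm, hkj.symm]

/-! ### The classification -/

theorem iso_list_of_isSparse {V : Type*} {G : SimpleGraph V} (hG : IsTwoConnected G)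
    (hdh : IsDistanceHereditary G) (hsp : IsSparse G) :
    Nonempty (G ≃g triangle) ∨ Nonempty (G ≃g square) ∨ Nonempty (G ≃g diamond) ∨
      Nonempty (G ≃g K 2 3) ∨ Nonempty (G ≃g K 2 4) ∨ Nonempty (G ≃g K33Minus) := by
  have hfin : Finite V := Nat.finite_of_card_ne_zero (by have := hG.two_lt_card; omega)
  have : Nontrivial (Fin 2 ⊕ Fin 3) := ⟨Sum.inl 0, Sum.inr 0, by simp⟩
  have : Nontrivial (Fin 2 ⊕ Fin 4) := ⟨Sum.inl 0, Sum.inr 0, by simp⟩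
  have : Nontrivial (Fin 3 ⊕ Fin 3) := ⟨Sum.inl 0, Sum.inr 0, by simp⟩
  rcases triangle_or_square_isIndContained hG hdh.hole_free with ⟨⟨φ⟩⟩ | ⟨⟨φ⟩⟩
  · rcases surjective_or_exists_eq_pair hG hdh hsp φ (by decide +kernel) (by decide +kernel)
      (by decide +kernel) with hs | ⟨x, hx, i, j, hij, h⟩
    · exact Or.inl (nonempty_iso_of_surjective φ hs)
    obtain ⟨ψ⟩ := diamond_isIndContained_of_triangle φ hx hij h
    exact Or.inr <| Or.inr <| Or.inl <| nonempty_iso_of_surjective ψ <|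
      surjective_of_card hG hdh hsp ψ (by decide +kernel) (by decide +kernel) (by decide +kernel)
  · rcases surjective_or_exists_eq_pair hG hdh hsp φ (by decide +kernel) (by decide +kernel)
      (by decide +kernel) with hs | ⟨x, hx, i, j, hij, h⟩
    · exact Or.inr <| Or.inl (nonempty_iso_of_surjective φ hs)
    obtain ⟨ψ⟩ := K23_isIndContained_of_square hdh.house_free φ hx hij h
    rcases surjective_or_exists_eq_pair hG hdh hsp ψ (by decide +kernel) (by decide +kernel)
      (by decide +kernel) with hs | ⟨x, hx, i, j, hij, h⟩
    · exact Or.inr <| Or.inr <| Or.inr <| Or.inl (nonempty_iso_of_surjective ψ hs)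
    rcases K24_or_K33Minus_isIndContained hdh.house_free ψ hx hij h with ⟨⟨χ⟩⟩ | ⟨⟨χ⟩⟩
    · exact Or.inr <| Or.inr <| Or.inr <| Or.inr <| Or.inl <| nonempty_iso_of_surjective χ <|
        surjective_of_card hG hdh hsp χ (by decide +kernel) (by decide +kernel)
          (by decide +kernel)
    · exact Or.inr <| Or.inr <| Or.inr <| Or.inr <| Or.inr <| nonempty_iso_of_surjective χ <|
        surjective_of_card hG hdh hsp χ (by decide +kernel) (by decide +kernel)
          (by decide +kernel)

end DecycMatching

theorem theorem6 {V : Type*} [Finite V] (G : SimpleGraph V)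
    (hcard : 3 ≤ Nat.card V)
    (hconn : DecycMatching.IsTwoConnected G)
    (hdh : DecycMatching.IsDistanceHereditary G) :
    DecycMatching.IsSparse G ↔
      (Nonempty (G ≃g DecycMatching.triangle) ∨
        Nonempty (G ≃g DecycMatching.square) ∨
        Nonempty (G ≃g DecycMatching.diamond) ∨
        Nonempty (G ≃g DecycMatching.K 2 3) ∨
        Nonempty (G ≃g DecycMatching.K 2 4) ∨
        Nonempty (G ≃g DecycMatching.K33Minus)) :=
  ⟨DecycMatching.iso_list_of_isSparse hconn hdh, DecycMatching.isSparse_of_iso_list⟩
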